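/- Let $(\Sigma,\mathrm{rk})$ be a ranked alphabet (a finite set of symbols with ranks in $\mathbb N$), let $T_\Sigma$ be the set of $\Sigma$-trees and $T_\Sigma(Q)$ the set of $\Sigma$-trees whose leaves may also be labelled by elements of a set $Q$, and let $\mathbb S$ be a commutative semiring that is zero-sum free, i.e. $s+s'=0$ implies $s=0=s'$ for all $s,s'\in\mathbb S$. Positions in trees are words over $\mathbb N$ (the children of a node of rank $k$ are numbered $1,\dots,k$), and $t|_v$ is the subtree of $t$ at the position $v$. A weighted tree grammar with constraints is a tuple $G=(Q,\Sigma,F,P,\mathrm{wt})$ with a finite set $Q$ of nonterminals, final weights $F\in\mathbb S^Q$, a finite set $P$ of productions $p=(\ell,q,E,I)$ with $\ell\in T_\Sigma(Q)\setminus Q$, $q\in Q$ and finite sets $E,I\subseteq\mathbb N^*\times\mathbb N^*$, and weights $\mathrm{wt}\in\mathbb S^P$. It is a *weighted tree automaton with constraints* (WTAc) if every left-hand side has the form $\ell=\sigma(q_1,\dots,q_k)$ with $\sigma\in\Sigma$ of rank $k$ and $q_1,\dots,q_k\in Q$; it is *classic* if for every production and every $(v,v')\in E\cup I$ both $v$ and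 $v'$ are positions of $\ell$ labelled by nonterminals. A tree $t\in T_\Sigma$ satisfies $(v,v')$ if $v,v'$ are positions of $t$ and $t|_v=t|_{v'}$; otherwise it dissatisfies $(v,v')$. For an input tree $t$, a production $p=(\ell,q,E,I)$ applied at the position $w$ rewrites $\xi\in T_\Sigma(Q)$ to $\xi[q]_w$ (the subtree of $\xi$ at $w$ replaced by $q$), provided that $\xi|_w=\ell$, that $t|_w$ satisfies all constraints in $E$, and that $t|_w$ dissatisfies all constraints in $I$. Let $D_G^q(t)$ be the set of sequences $d=(p_1,w_1)\cdots(p_n,w_n)$ of such steps that rewrite $t$ to $q\in Q$ and are left-most, i.e. $w_1\prec\dots\prec w_n$ in the lexicographic order in which prefixes are larger. The weighted tree language $G\in\mathbb S^{T_\Sigma}$ generated by $G$ is $$G_t=\sum_{q\in Q,\ d\in D_G^q(t)}F_q\cdot\prod_{i=1}^n\mathrm{wt}(p_i)\qquad(t\in T_\Sigma),$$ and $\mathrm{supp}(G)=\{t\in T_\Sigma\mid G_t\ne 0\}$. **Theorem.** For all WTAc $G$ and $G'$ over $\Sigma$ and $\mathbb S$ there exists a WTAc $H$ over $\Sigma$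 and $\mathbb S$ with $H=G|_{\mathrm{supp}(G')}$, i.e. $H_t=G_t$ for every $t\in\mathrm{supp}(G')$ and $H_t=0$ for every $t\in T_\Sigma\setminus\mathrm{supp}(G')$. Moreover, if $G$ and $G'$ are classic WTAc, then there exists a classic WTAc $H$ with this property. -/

import Mathlib

universe u v w

namespace WTGc

/-- `RTree rk Z` is the set `T_Σ(Z)` of trees over the ranked alphabet `(Sg, rk)` indexed by `Z`:
leaves are elements of `Z`, and a symbol `σ` has exactly `rk σ` children. -/
inductive RTree {Sg : Type u} (rk : Sg → ℕ) (Z : Type w) : Type (max u w)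
  | var (z : Z) : RTree rk Z
  | node (σ : Sg) (ts : Fin (rk σ) → RTree rk Z) : RTree rk Z

/-- The set `T_Σ = T_Σ(∅)` of input trees. -/
abbrev ITree {Sg : Type u} (rk : Sg → ℕ) : Type u := RTree rk Empty

/-- Positions are words over `ℕ`; the children of a node of rank `k` are numbered `1, …, k`. -/
abbrev Pos : Type := List ℕ

namespace RTree

variable {Sg : Type u} {rk : Sg → ℕ} {Z : Type w}

/-- The inclusion `T_Σ ⊆ T_Σ(Z)`. -/
def embed (Z : Type w) : ITree rk → RTree rk Z
  | var z => z.elim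
  | node σ ts => node σ fun i => embed Z (ts i)

/-- The subtree `t|_v`, which is `none` if `v` is not a position of `t`. -/
def subtree? : RTree rk Z → Pos → Option (RTree rk Z)
  | t, [] => some t
  | var _, _ :: _ => none
  | node σ ts, i :: v => if h : 1 ≤ i ∧ i ≤ rk σ then (ts ⟨i - 1, by omega⟩).subtree? v else none

/-- The set `pos(t)` of positions of `t`. -/
def pos (t : RTree rk Z) : Set Pos := {v | ∃ s, t.subtree? v = some s}

/-- The set `pos_Z(t)` of positions of `t` that are labelled by an element of `Z`. -/
def varPos (t : RTree rk Z) : Set Pos := {v | ∃ z, t.subtree? v = some (var z)}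

/-- The tree `t[s]_v` obtained from `t` by replacing the subtree at the position `v` by `s`
(and `t` itself if `v` is not a position of `t`). -/
def replace : RTree rk Z → Pos → RTree rk Z → RTree rk Z
  | _, [], s => s
  | var z, _ :: _, _ => var z
  | node σ ts, i :: v, s =>
      node σ fun j => if (j : ℕ) + 1 = i then (ts j).replace v s else ts j

/-- The recursive description of `pos(t)` for `t = σ(t₁, …, t_k)`. -/
theorem pos_node (σ : Sg) (ts : Fin (rk σ) → RTree rk Z) :
    (node σ ts).pos = {[]} ∪ ⋃ i : Fin (rk σ), (fun v => ((i : ℕ) + 1) :: v) '' (ts i).pos := by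
  ext v
  cases v with
  | nil => simp [pos, subtree?]
  | cons i v =>
    simp only [pos, subtree?, Set.mem_ofPred_eq, Set.mem_union, Set.mem_singleton_iff,
      reduceCtorEq, false_or, Set.mem_iUnion, Set.mem_image, List.cons.injEq]
    constructor
    · rintro ⟨s, hs⟩
      split_ifs at hs with h
      exact ⟨⟨i - 1, by omega⟩, v, ⟨s, hs⟩, by simp only; omega, rfl⟩
    · rintro ⟨j, v', ⟨s, hs⟩, rfl, rfl⟩
      have := j.isLt
      exact ⟨s, by simpa [show (j : ℕ) + 1 ≤ rk σ by omega] using hs⟩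

theorem pos_finite : ∀ t : RTree rk Z, t.pos.Finite
  | var z => by
      refine (Set.finite_singleton ([] : Pos)).subset ?_
      rintro (_ | ⟨i, v⟩) ⟨s, hs⟩
      · rfl
      · simp [subtree?] at hs
  | node σ ts => by
      rw [pos_node]
      exact (Set.finite_singleton _).union
        (Set.finite_iUnion fun i => (pos_finite (ts i)).image _)

/-- The input tree `t` satisfies the constraint `c = (v, v')`:
both `v` and `v'` are positions of `t`, and `t|_v = t|_{v'}`. -/
def Satisfies (t : ITree rk) (c : Pos × Pos) : Prop :=
  c.1 ∈ t.pos ∧ c.2 ∈ t.pos ∧ t.subtree? c.1 = t.subtree? c.2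

end RTree

open RTree

/-- Productions `(ℓ, q, E, I)` with left-hand side `ℓ ∈ T_Σ(Q) \ Q`, target nonterminal `q ∈ Q`,
equality constraints `E` and inequality constraints `I`. -/
structure Production {Sg : Type u} (rk : Sg → ℕ) (Q : Type w) : Type (max u w) where
  lhs : RTree rk Q
  tgt : Q
  E : Finset (Pos × Pos)
  I : Finset (Pos × Pos)
  lhs_ne : ∀ q : Q, lhs ≠ var q

namespace Production

variable {Sg : Type u} {rk : Sg → ℕ} {Q : Type w}

/-- The left-hand side has the form `σ(q₁, …, q_k)`. -/
def IsNormalized (p : Production rk Q) : Prop :=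
  ∃ (σ : Sg) (qs : Fin (rk σ) → Q), p.lhs = node σ fun i => var (qs i)

/-- Constraints only refer to nonterminal-labelled positions of the left-hand side. -/
def IsClassic (p : Production rk Q) : Prop :=
  ∀ c : Pos × Pos, c ∈ p.E ∨ c ∈ p.I → c.1 ∈ p.lhs.varPos ∧ c.2 ∈ p.lhs.varPos

/-- The constraints of `p` are fulfilled on `t`: all constraints in `E` are satisfied by `t`, and
all constraints in `I` are dissatisfied by `t`. -/
def Fulfilled (p : Production rk Q) (t : ITree rk) : Prop :=
  (∀ c ∈ p.E, t.Satisfies c) ∧ (∀ c ∈ p.I, ¬ t.Satisfies c)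

end Production

/-- Weighted tree grammars with constraints over the ranked alphabet `(Sg, rk)` and the
semiring `S`. -/
structure Grammar {Sg : Type u} (rk : Sg → ℕ) (S : Type v) : Type (max u v (w + 1)) where
  /-- nonterminals -/
  Q : Type w
  [fintypeQ : Fintype Q]
  /-- final weights -/
  F : Q → S
  /-- productions -/
  P : Finset (Production rk Q)
  /-- weights of the productions -/
  wt : {p // p ∈ P} → S

attribute [instance] Grammar.fintypeQ

/-- The strict lexicographic order `≺` on positions in which prefixes are larger. -/
def PosLT : Pos → Pos → Prop
  | [], _ => False
  | _ :: _, [] => True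
  | i :: v, j :: v' => i < j ∨ (i = j ∧ PosLT v v')

theorem PosLT.irrefl : ∀ v : Pos, ¬ PosLT v v
  | [] => id
  | i :: v => by simpa [PosLT] using PosLT.irrefl v

theorem PosLT.trans : ∀ {a b c : Pos}, PosLT a b → PosLT b c → PosLT a c
  | [], _, _, h, _ => h.elim
  | _ :: _, [], _, _, h => h.elim
  | _ :: _, _ :: _, [], _, _ => trivial
  | i :: a, j :: b, k :: c, h, h' => by
      rcases h with h | ⟨rfl, h⟩ <;> rcases h' with h' | ⟨rfl, h'⟩
      · exact Or.inl (h.trans h')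
      · exact Or.inl h
      · exact Or.inl h'
      · exact Or.inr ⟨rfl, h.trans h'⟩

namespace Grammar

variable {Sg : Type u} {rk : Sg → ℕ} {S : Type v}

/-- The grammar is a weighted tree automaton with constraints. -/
def IsAutomaton (G : Grammar.{u, v, w} rk S) : Prop := ∀ p ∈ G.P, p.IsNormalized

def IsClassic (G : Grammar.{u, v, w} rk S) : Prop := ∀ p ∈ G.P, p.IsClassic

/-- Sequences `(p₁, w₁) ⋯ (p_n, w_n) ∈ (P × ℕ*)*`. -/
abbrev Seq (G : Grammar.{u, v, w} rk S) : Type (max u w) := List ({p // p ∈ G.P} × Pos)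

/-- The derivation step `ξ ⇒ ζ` for the input tree `t` with the production `p` at the
position `x`. -/
def Step (G : Grammar.{u, v, w} rk S) (t : ITree rk) (p : {p // p ∈ G.P}) (x : Pos)
    (ξ ζ : RTree rk G.Q) : Prop :=
  ξ.subtree? x = some p.1.lhs ∧ ζ = ξ.replace x (var p.1.tgt) ∧
    ∃ s : ITree rk, t.subtree? x = some s ∧ p.1.Fulfilled s

/-- The sequence `d` of derivation steps for the input tree `t` leads from `ξ` to `ζ`. -/
def Derives (G : Grammar.{u, v, w} rk S) (t : ITree rk) :
    RTree rk G.Q → G.Seq → RTree rk G.Q → Prop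
  | ξ, [], ζ => ξ = ζ
  | ξ, (p, x) :: d, ζ => ∃ ξ', G.Step t p x ξ ξ' ∧ G.Derives t ξ' d ζ

/-- A sequence is left-most if `w₁ ≺ w₂ ≺ ⋯ ≺ w_n`. -/
def IsLeftmost {G : Grammar.{u, v, w} rk S} (d : G.Seq) : Prop :=
  d.IsChain fun a b => PosLT a.2 b.2

/-- The set `D_G^q(t)` of complete left-most derivations for `t` to `q`. -/
def D (G : Grammar.{u, v, w} rk S) (q : G.Q) (t : ITree rk) : Set G.Seq :=
  {d | G.Derives t (t.embed G.Q) d (var q) ∧ IsLeftmost d}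

theorem D_finite (G : Grammar.{u, v, w} rk S) (q : G.Q) (t : ITree rk) : (G.D q t).Finite := by
  have hmem : ∀ (d : G.Seq) (ξ ζ : RTree rk G.Q), G.Derives t ξ d ζ →
      ∀ a ∈ d, a.2 ∈ t.pos := by
    intro d
    induction d with
    | nil => simp
    | cons b d ih =>
      rintro ξ ζ ⟨ξ', ⟨-, -, s, hs, -⟩, h⟩ a ha
      rcases List.mem_cons.1 ha with rfl | ha
      · exact ⟨s, hs⟩
      · exact ih ξ' ζ h a ha
  let A : Set ({p // p ∈ G.P} × Pos) := {a | a.2 ∈ t.pos}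
  have hA : A.Finite :=
    (Set.finite_univ.prod t.pos_finite).subset fun a ha => ⟨Set.mem_univ _, ha⟩
  have := hA.fintype
  refine ((List.finite_length_le A (Fintype.card A)).image (List.map Subtype.val)).subset ?_
  rintro d ⟨hd, hl⟩
  have hp : d.Pairwise fun a b => PosLT a.2 b.2 := by
    have : IsTrans ({p // p ∈ G.P} × Pos) fun a b => PosLT a.2 b.2 := ⟨fun _ _ _ => PosLT.trans⟩
    exact List.isChain_iff_pairwise.1 hl
  have hn : d.Nodup := List.Pairwise.imp (fun {a b} h (hab : a = b) =>
    PosLT.irrefl b.2 (by rwa [hab] at h)) hp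
  have hm : ∀ a ∈ d, a ∈ A := hmem d _ _ hd
  clear hd hl hp
  lift d to List A using hm
  exact ⟨d, (List.Nodup.of_map _ hn).length_le_card, rfl⟩

/-- The weight of a derivation: the product of the weights of its productions. -/
def weight [CommSemiring S] (G : Grammar.{u, v, w} rk S) (d : G.Seq) : S :=
  (d.map fun a => G.wt a.1).prod

/-- The weighted tree language generated by `G`:
`G_t = ∑_{q ∈ Q, d ∈ D_G^q(t)} F_q · wt_G(d)`. -/
noncomputable def lang [CommSemiring S] (G : Grammar.{u, v, w} rk S) (t : ITree rk) : S :=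
  ∑ q : G.Q, ∑ d ∈ (G.D_finite q t).toFinset, G.F q * G.weight d

end Grammar

/-- A semiring is zero-sum free if `s + s' = 0` implies `s = 0 = s'`. -/
def ZeroSumFree (S : Type v) [CommSemiring S] : Prop :=
  ∀ s s' : S, s + s' = 0 → s = 0 ∧ s' = 0

end WTGc

namespace WTGc

open RTree

/-! ### Subtrees and replacement below the root. -/

namespace RTree

variable {Sg : Type u} {rk : Sg → ℕ} {Z : Type w}

/-! The support of `G'` is recognized by a finite deterministic bottom-up device whose transitions
depend on the root symbol, on which of finitely many constraints hold at the root, and on the states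
of the direct subtrees; a product construction then restricts `G` to it.

Recognition (`exists_lang_ne_zero_iff`, `profiles_node`). In a zero-sum free semiring nothing
cancels, so `G'` is non-zero at `t` iff some derivation `d` to some `q` has F_q · wt(d) ≠ 0. Zero
divisors may exist, so non-zero factors do not settle this. By commutativity, however, the product
depends only on how often each production occurs in `d`. The exponent vectors that make the product
vanish form an upward closed set, which by Dickson's lemma has finitely many minimal elements, so
counts may be truncated at some N (`exists_threshold`). The state of `t` is the set of all pairs of
a target nonterminal and the truncated counts of a derivation to it. Truncated counts can be added
up from the subtrees (`min_add_sum_min`), so this state is computed bottom-up.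

Product (`lang_restrict`). A production of `G` is paired with subtree states and with a guess C of
the satisfied constraints of `G'`. The guess is enforced by demanding C as equality constraints and
its complement as inequality constraints. For each tree exactly one guess is right, so the
derivations of `G` are neither lost nor counted twice.

Both halves rest on one decomposition: a left-most derivation of σ(t₁, …, t_k) consists of left-most
derivations of the t_i followed by one production at the root (`graft_mem_D`,
`exists_graft_of_mem_D`, `graft_inj`). -/

theorem subtree?_node_succ (σ : Sg) (ts : Fin (rk σ) → RTree rk Z) (i : Fin (rk σ)) (x : Pos) :
    (node σ ts).subtree? (((i : ℕ) + 1) :: x) = (ts i).subtree? x := by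
  have := i.isLt
  simp [subtree?, show (i : ℕ) + 1 ≤ rk σ by omega]

theorem replace_node_succ (σ : Sg) (ts : Fin (rk σ) → RTree rk Z) (i : Fin (rk σ)) (x : Pos)
    (s : RTree rk Z) :
    (node σ ts).replace (((i : ℕ) + 1) :: x) s =
      node σ (Function.update ts i ((ts i).replace x s)) := by
  simp only [replace, node.injEq, heq_eq_eq, true_and]
  funext j
  by_cases h : j = i
  · subst h; simp
  · have : (j : ℕ) ≠ i := fun h' => h (Fin.ext h')
    simp [h, this]

theorem exists_of_cons_mem_pos {σ : Sg} {ts : Fin (rk σ) → RTree rk Z} {j : ℕ} {x : Pos}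
    (h : j :: x ∈ (node σ ts).pos) : ∃ i : Fin (rk σ), j = (i : ℕ) + 1 := by
  obtain ⟨s, hs⟩ := h
  simp only [subtree?] at hs
  split_ifs at hs with h
  exact ⟨⟨j - 1, by omega⟩, by simp only; omega⟩

theorem subtree?_nil (t : RTree rk Z) : t.subtree? [] = some t := by
  cases t <;> rfl

theorem replace_nil (t s : RTree rk Z) : t.replace [] s = s := by
  cases t <;> rfl

end RTree

/-! ### Lists of labelled positions -/

section PosList

variable {α : Type*}

/-- The labelled positions of `d` are listed in strictly increasing order. -/
def Sorted (d : List (α × Pos)) : Prop := d.Pairwise fun a b => PosLT a.2 b.2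

theorem Sorted.nodup {d : List (α × Pos)} (h : Sorted d) : d.Nodup :=
  List.Pairwise.imp (fun {a b} h (hab : a = b) => PosLT.irrefl b.2 (by rwa [hab] at h)) h

/-- Since ≺ is a strict order, a sorted list is determined by its members; identities between sorted
lists thus reduce to membership. -/
theorem Sorted.ext {d d' : List (α × Pos)} (h : Sorted d) (h' : Sorted d')
    (hm : ∀ a, a ∈ d ↔ a ∈ d') : d = d' := by
  refine ((List.perm_ext_iff_of_nodup h.nodup h'.nodup).2 hm).eq_of_pairwise ?_ h h'
  intro a b _ _ hab hba
  exact (PosLT.irrefl _ (hab.trans hba)).elim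

/-- The part of `d` that lies in the `i`-th direct subtree. -/
def proj (i : ℕ) (d : List (α × Pos)) : List (α × Pos) :=
  d.filterMap fun a => match a.2 with
    | [] => none
    | j :: x => if j = i + 1 then some (a.1, x) else none

@[simp] theorem proj_nil (i : ℕ) : proj i ([] : List (α × Pos)) = [] := rfl

theorem proj_cons_self (i : ℕ) (p : α) (x : Pos) (d : List (α × Pos)) :
    proj i ((p, (i + 1) :: x) :: d) = (p, x) :: proj i d := by
  simp [proj]

theorem proj_cons_ne {i j : ℕ} (h : j ≠ i) (p : α) (x : Pos) (d : List (α × Pos)) :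
    proj i ((p, (j + 1) :: x) :: d) = proj i d := by
  simp [proj, h]

theorem mem_proj {i : ℕ} {d : List (α × Pos)} {p : α} {x : Pos} :
    (p, x) ∈ proj i d ↔ (p, (i + 1) :: x) ∈ d := by
  simp only [proj, List.mem_filterMap]
  constructor
  · rintro ⟨⟨p', _ | ⟨j, y⟩⟩, h, h'⟩
    · simp at h'
    · simp only [Option.ite_none_right_eq_some, Option.some.injEq, Prod.mk.injEq] at h'
      obtain ⟨rfl, rfl, rfl⟩ := h'
      exact h
  · intro h
    exact ⟨_, h, by simp⟩

theorem Sorted.proj {d : List (α × Pos)} (h : Sorted d) (i : ℕ) : Sorted (proj i d) := by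
  refine List.Pairwise.filterMap _ ?_ h
  rintro ⟨p, _ | ⟨j, x⟩⟩ ⟨p', _ | ⟨j', x'⟩⟩ hlt b hb b' hb'
  all_goals simp only [Option.ite_none_right_eq_some, Option.some.injEq,
    reduceCtorEq] at hb hb'
  obtain ⟨rfl, rfl⟩ := hb
  obtain ⟨rfl, rfl⟩ := hb'
  simpa [PosLT] using hlt

/-- The concatenation of position lists for the direct subtrees. -/
def join {k : ℕ} (ds : Fin k → List (α × Pos)) : List (α × Pos) :=
  (List.ofFn fun i => (ds i).map fun a => (a.1, ((i : ℕ) + 1) :: a.2)).flatten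

theorem mem_join {k : ℕ} {ds : Fin k → List (α × Pos)} {a : α × Pos} :
    a ∈ join ds ↔ ∃ i : Fin k, ∃ x, a.2 = ((i : ℕ) + 1) :: x ∧ (a.1, x) ∈ ds i := by
  simp only [join, List.mem_flatten, List.mem_ofFn]
  constructor
  · rintro ⟨_, ⟨i, rfl⟩, h⟩
    obtain ⟨b, hb, rfl⟩ := List.mem_map.1 h
    exact ⟨i, b.2, rfl, hb⟩
  · rintro ⟨i, x, hx, h⟩
    exact ⟨_, ⟨i, rfl⟩, List.mem_map.2 ⟨_, h, by rw [← hx]⟩⟩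

theorem sorted_join {k : ℕ} {ds : Fin k → List (α × Pos)} (h : ∀ i, Sorted (ds i)) :
    Sorted (join ds) := by
  rw [Sorted, join, List.pairwise_flatten]
  constructor
  · intro l hl
    obtain ⟨i, rfl⟩ := (List.mem_ofFn' _ _).1 hl
    rw [List.pairwise_map]
    exact (h i).imp fun hab => Or.inr ⟨rfl, hab⟩
  · rw [List.pairwise_ofFn]
    intro i j hij a ha b hb
    obtain ⟨a, -, rfl⟩ := List.mem_map.1 ha
    obtain ⟨b, -, rfl⟩ := List.mem_map.1 hb
    exact Or.inl (by simpa using hij)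

theorem proj_join {k : ℕ} {ds : Fin k → List (α × Pos)} (h : ∀ i, Sorted (ds i)) (i : Fin k) :
    proj i (join ds) = ds i := by
  refine ((sorted_join h).proj i).ext (h i) ?_
  rintro ⟨p, x⟩
  rw [mem_proj, mem_join]
  constructor
  · rintro ⟨j, y, hy, hm⟩
    simp only [List.cons.injEq, Nat.add_right_cancel_iff] at hy
    obtain ⟨hij, rfl⟩ := hy
    rwa [Fin.ext hij]
  · exact fun hm => ⟨i, x, rfl, hm⟩

theorem join_proj {k : ℕ} {d : List (α × Pos)} (h : Sorted d)
    (hd : ∀ a ∈ d, ∃ i : Fin k, ∃ x, a.2 = ((i : ℕ) + 1) :: x) :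
    join (fun i : Fin k => proj i d) = d := by
  refine (sorted_join fun i : Fin k => h.proj i).ext h ?_
  rintro ⟨p, y⟩
  rw [mem_join]
  constructor
  · rintro ⟨i, x, rfl, hm⟩
    exact mem_proj.1 hm
  · intro hm
    obtain ⟨i, x, rfl⟩ := hd _ hm
    exact ⟨i, x, rfl, mem_proj.2 hm⟩

theorem prod_map_join {M : Type*} [CommMonoid M] {k : ℕ} (ds : Fin k → List (α × Pos))
    (f : α → M) :
    ((join ds).map fun a => f a.1).prod = ∏ i, ((ds i).map fun a => f a.1).prod := by
  simp [join, List.map_flatten, List.prod_flatten, List.map_ofFn, List.prod_ofFn,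
    Function.comp_def]

end PosList

/-! ### Decomposition of derivations at the root. -/

namespace Grammar

variable {Sg : Type u} {rk : Sg → ℕ} {S : Type v}

theorem isLeftmost_iff {G : Grammar.{u, v, w} rk S} {d : G.Seq} : IsLeftmost d ↔ Sorted d := by
  have : IsTrans ({p // p ∈ G.P} × Pos) fun a b => PosLT a.2 b.2 := ⟨fun _ _ _ => PosLT.trans⟩
  exact List.isChain_iff_pairwise

variable (G : Grammar.{u, v, w} rk S)

theorem mem_pos_of_derives {t : ITree rk} : ∀ {d : G.Seq} {ξ ζ : RTree rk G.Q},
    G.Derives t ξ d ζ → ∀ a ∈ d, a.2 ∈ t.pos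
  | [], _, _, _, a, ha => by simp at ha
  | b :: d, ξ, ζ, ⟨ξ', ⟨_, _, s, hs, _⟩, h⟩, a, ha => by
      rcases List.mem_cons.1 ha with rfl | ha
      · exact ⟨s, hs⟩
      · exact mem_pos_of_derives h a ha

theorem derives_append {t : ITree rk} {e : G.Seq} {ζ : RTree rk G.Q} :
    ∀ {d : G.Seq} {ξ : RTree rk G.Q},
      G.Derives t ξ (d ++ e) ζ ↔ ∃ ξ', G.Derives t ξ d ξ' ∧ G.Derives t ξ' e ζ
  | [], ξ => by simp [Derives]
  | b :: d, ξ => by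
      simp only [List.cons_append, Derives, derives_append]
      constructor
      · rintro ⟨ξ₁, h₁, ξ₂, h₂, h₃⟩
        exact ⟨ξ₂, ⟨ξ₁, h₁, h₂⟩, h₃⟩
      · rintro ⟨ξ₂, ⟨ξ₁, h₁, h₂⟩, h₃⟩
        exact ⟨ξ₁, h₁, ξ₂, h₂, h₃⟩

theorem step_node_iff {σ : Sg} {ts : Fin (rk σ) → ITree rk} {p : {p // p ∈ G.P}}
    {i : Fin (rk σ)} {x : Pos} {ξs : Fin (rk σ) → RTree rk G.Q} {ζ : RTree rk G.Q} :
    G.Step (node σ ts) p (((i : ℕ) + 1) :: x) (node σ ξs) ζ ↔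
      ∃ ξ', G.Step (ts i) p x (ξs i) ξ' ∧ ζ = node σ (Function.update ξs i ξ') := by
  simp only [Step, subtree?_node_succ, replace_node_succ]
  constructor
  · rintro ⟨h₁, h₂, h₃⟩
    exact ⟨_, ⟨h₁, rfl, h₃⟩, h₂⟩
  · rintro ⟨_, ⟨h₁, rfl, h₃⟩, h₂⟩
    exact ⟨h₁, h₂, h₃⟩

/-- A step strictly below the root changes one direct subtree and reads only that part of the input
tree, so steps in different subtrees are independent. The order of the steps plays no role here. -/
theorem derives_node_iff {σ : Sg} {ts : Fin (rk σ) → ITree rk} {ζ : RTree rk G.Q} :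
    ∀ {d : G.Seq} {ξs : Fin (rk σ) → RTree rk G.Q},
      (∀ a ∈ d, ∃ i : Fin (rk σ), ∃ x, a.2 = ((i : ℕ) + 1) :: x) →
      (G.Derives (node σ ts) (node σ ξs) d ζ ↔
        ∃ ζs, ζ = node σ ζs ∧ ∀ i : Fin (rk σ), G.Derives (ts i) (ξs i) (proj i d) (ζs i))
  | [], ξs, _ => by
      simp only [Derives, proj_nil]
      constructor
      · rintro rfl
        exact ⟨ξs, rfl, fun _ => rfl⟩
      · rintro ⟨ζs, rfl, h⟩
        rw [funext h]
  | (p, y) :: d, ξs, hd => by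
      obtain ⟨i, x, hy⟩ := hd _ List.mem_cons_self
      dsimp only at hy
      subst hy
      have ih := fun ξs => derives_node_iff (ts := ts) (ζ := ζ) (d := d) (ξs := ξs)
        fun a ha => hd a (List.mem_cons_of_mem _ ha)
      simp only [Derives, step_node_iff]
      constructor
      · rintro ⟨_, ⟨ξ', hs, rfl⟩, h⟩
        obtain ⟨ζs, rfl, h'⟩ := (ih _).1 h
        refine ⟨ζs, rfl, fun j => ?_⟩
        have hj := h' j
        by_cases hij : j = i
        · subst hij
          rw [proj_cons_self]
          exact ⟨ξ', hs, by simpa using hj⟩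
        · rw [proj_cons_ne fun h' => hij (Fin.ext h').symm]
          simpa [hij] using hj
      · rintro ⟨ζs, rfl, h⟩
        have hi := h i
        rw [proj_cons_self] at hi
        obtain ⟨ξ', hs, hi⟩ := hi
        refine ⟨_, ⟨ξ', hs, rfl⟩, (ih _).2 ⟨ζs, rfl, fun j => ?_⟩⟩
        by_cases hij : j = i
        · subst hij
          simpa using hi
        · have hj := h j
          rw [proj_cons_ne fun h' => hij (Fin.ext h').symm] at hj
          simpa [hij] using hj

/-- The derivation that first processes the direct subtrees and then applies `p` at the root. -/
def graft {G : Grammar.{u, v, w} rk S} {k : ℕ} (p : {p // p ∈ G.P}) (ds : Fin k → G.Seq) : G.Seq :=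
  join ds ++ [(p, [])]

/-- The production `p` can be applied at the root of `t = σ(t₁, …, t_k)` after the direct subtrees
have been rewritten to `qs`. -/
def Applicable {Q : Type w} (p : Production rk Q) (q : Q) (σ : Sg) (qs : Fin (rk σ) → Q)
    (t : ITree rk) : Prop :=
  p.lhs = node σ (fun i => var (qs i)) ∧ p.tgt = q ∧ p.Fulfilled t

theorem mem_D {q : G.Q} {t : ITree rk} {d : G.Seq} :
    d ∈ G.D q t ↔ G.Derives t (t.embed G.Q) d (var q) ∧ Sorted d :=
  and_congr_right fun _ => isLeftmost_iff

variable {G}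

theorem graft_mem_D {q : G.Q} {σ : Sg} {ts : Fin (rk σ) → ITree rk} {p : {p // p ∈ G.P}}
    {qs : Fin (rk σ) → G.Q} {ds : Fin (rk σ) → G.Seq}
    (hp : Applicable p.1 q σ qs (node σ ts)) (hds : ∀ i, ds i ∈ G.D (qs i) (ts i)) :
    graft p ds ∈ G.D q (node σ ts) := by
  simp only [mem_D] at hds ⊢
  have hs := fun i => (hds i).2
  constructor
  · rw [graft, derives_append]
    refine ⟨node σ fun i => var (qs i), ?_, ?_⟩
    · refine (derives_node_iff G fun a ha => ?_).2 ⟨_, rfl, fun i => ?_⟩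
      · obtain ⟨i, x, hx, -⟩ := mem_join.1 ha
        exact ⟨i, x, hx⟩
      · rw [proj_join hs]
        exact (hds i).1
    · refine ⟨_, ⟨?_, rfl, _, subtree?_nil _, hp.2.2⟩, ?_⟩
      · rw [subtree?_nil, hp.1]
      · rw [replace_nil, hp.2.1]
        rfl
  · rw [graft, Sorted, List.pairwise_append]
    refine ⟨sorted_join hs, List.pairwise_singleton _ _, ?_⟩
    rintro a ha b hb
    obtain ⟨i, x, hx, -⟩ := mem_join.1 ha
    rw [List.mem_singleton.1 hb, hx]
    trivial

/-- The root is the ≺-largest position, so a left-most derivation can use it only in its last step.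
It must do so, because steps below the root keep the root symbol and never produce a nonterminal.
The normalized left-hand side of that last production forces each direct subtree to have been
rewritten to a nonterminal. -/
theorem exists_graft_of_mem_D (hG : G.IsAutomaton) {q : G.Q} {σ : Sg}
    {ts : Fin (rk σ) → ITree rk} {d : G.Seq} (hd : d ∈ G.D q (node σ ts)) :
    ∃ (p : {p // p ∈ G.P}) (qs : Fin (rk σ) → G.Q) (ds : Fin (rk σ) → G.Seq),
      Applicable p.1 q σ qs (node σ ts) ∧ (∀ i, ds i ∈ G.D (qs i) (ts i)) ∧ d = graft p ds := by
  obtain ⟨hd, hs⟩ := (G.mem_D).1 hd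
  have hpos := mem_pos_of_derives G hd
  have hne : ∀ d' : G.Seq, (∀ a ∈ d', a.2 ≠ []) → (∀ a ∈ d', a ∈ d) →
      ∀ a ∈ d', ∃ i : Fin (rk σ), ∃ x, a.2 = ((i : ℕ) + 1) :: x := by
    intro d' h₁ h₂ a ha
    have h₃ := hpos a (h₂ a ha)
    have h₄ := h₁ a ha
    rcases a with ⟨p, _ | ⟨j, x⟩⟩
    · exact (h₄ rfl).elim
    · obtain ⟨i, rfl⟩ := exists_of_cons_mem_pos h₃
      exact ⟨i, x, rfl⟩
  rcases List.eq_nil_or_concat d with rfl | ⟨d', ⟨p, x⟩, rfl⟩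
  · simp [Derives, embed] at hd
  rw [List.concat_eq_append] at *
  have hs' := List.pairwise_append.1 hs
  have hlt : ∀ a ∈ d', PosLT a.2 x := fun a ha => hs'.2.2 a ha _ (List.mem_singleton.2 rfl)
  have hne' : ∀ a ∈ d', a.2 ≠ [] := by
    intro a ha h
    have := hlt a ha
    rw [h] at this
    exact this
  -- Otherwise every step would lie below the root and the result would still be a `node`.
  have hx : x = [] := by
    by_contra hx
    have := (derives_node_iff G (hne (d' ++ [(p, x)]) (by
      intro a ha
      rcases List.mem_append.1 ha with ha | ha
      · exact hne' a ha
      · rw [List.mem_singleton.1 ha]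
        exact hx) fun _ => id)).1 hd
    simp at this
  subst hx
  obtain ⟨ξ, h₁, ζ, ⟨h₂, h₃, s, h₄, h₅⟩, h₆⟩ := (derives_append G).1 hd
  have hd' := hne d' hne' fun a ha => List.mem_append_left _ ha
  obtain ⟨ζs, rfl, h₇⟩ := (derives_node_iff G hd').1 h₁
  rw [subtree?_nil, Option.some.injEq] at h₂ h₄
  subst h₄
  obtain ⟨τ, qs, hqs⟩ := hG p.1 p.2
  rw [hqs] at h₂
  obtain ⟨rfl, h₂⟩ := node.inj h₂
  obtain rfl := eq_of_heq h₂
  rw [replace_nil] at h₃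
  have h₈ : var p.1.tgt = var q := h₃.symm.trans h₆
  refine ⟨p, qs, fun i => proj i d', ⟨hqs, by simpa using h₈, h₅⟩, fun i => ?_, ?_⟩
  · exact (G.mem_D).2 ⟨h₇ i, Sorted.proj hs'.1 _⟩
  · rw [graft, join_proj hs'.1 hd']

/-- The last entry gives the production, and projecting the remaining list to the subtrees recovers
their derivations. -/
theorem graft_inj {σ : Sg} {ts : Fin (rk σ) → ITree rk} {p p' : {p // p ∈ G.P}}
    {qs qs' : Fin (rk σ) → G.Q} {ds ds' : Fin (rk σ) → G.Seq}
    (hds : ∀ i, ds i ∈ G.D (qs i) (ts i)) (hds' : ∀ i, ds' i ∈ G.D (qs' i) (ts i))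
    (h : graft p ds = graft p' ds') : p = p' ∧ ds = ds' := by
  obtain ⟨h₁, h₂⟩ := List.append_inj' h rfl
  refine ⟨by simpa using h₂, funext fun i => ?_⟩
  rw [← proj_join (fun i => ((G.mem_D).1 (hds i)).2) i, h₁,
    proj_join (fun i => ((G.mem_D).1 (hds' i)).2) i]

theorem weight_graft [CommSemiring S] {k : ℕ} (p : {p // p ∈ G.P}) (ds : Fin k → G.Seq) :
    G.weight (graft p ds) = G.wt p * ∏ i, G.weight (ds i) := by
  simp [weight, graft, prod_map_join ds G.wt, mul_comm]

open Classical in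
/-- The number of uses of the production `r` in `d`. -/
noncomputable def mult (d : G.Seq) (r : {p // p ∈ G.P}) : ℕ := d.countP fun a => a.1 = r

open Classical in
theorem mult_graft {k : ℕ} (p r : {p // p ∈ G.P}) (ds : Fin k → G.Seq) :
    mult (graft p ds) r = (if p = r then 1 else 0) + ∑ i, mult (ds i) r := by
  simp [mult, graft, join, List.countP_flatten, List.map_ofFn, List.sum_ofFn,
    Function.comp_def, List.countP_map, List.countP_cons, add_comm]

/-- The total weight of the derivations of `t` to `q`. -/
noncomputable def value [CommSemiring S] (G : Grammar.{u, v, w} rk S) (q : G.Q) (t : ITree rk) :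
    S :=
  ∑ d ∈ (G.D_finite q t).toFinset, G.weight d

theorem lang_eq [CommSemiring S] (t : ITree rk) :
    G.lang t = ∑ q, G.F q * G.value q t := by
  simp only [lang, value, Finset.mul_sum]

open Classical in
-- Grafting is a bijection onto the derivations of the whole tree, and distributivity turns the sum
-- over tuples of derivations into a product of sums.
theorem value_node [CommSemiring S] (hG : G.IsAutomaton) (q : G.Q) (σ : Sg)
    (ts : Fin (rk σ) → ITree rk) :
    G.value q (node σ ts) = ∑ p : {p // p ∈ G.P}, ∑ qs : Fin (rk σ) → G.Q,
      if Applicable p.1 q σ qs (node σ ts) then G.wt p * ∏ i, G.value (qs i) (ts i) else 0 := by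
  rw [← Fintype.sum_prod_type', ← Finset.sum_filter]
  simp only [value, Finset.prod_univ_sum, Finset.mul_sum]
  rw [Finset.sum_sigma']
  symm
  refine Finset.sum_bij (fun a _ => graft a.1.1 a.2) ?_ ?_ ?_ ?_
  · rintro ⟨⟨p, qs⟩, ds⟩ h
    simp only [Finset.mem_sigma, Finset.mem_filter, Finset.mem_univ, true_and, Fintype.mem_piFinset,
      Set.Finite.mem_toFinset] at h ⊢
    exact graft_mem_D h.1 h.2
  · rintro ⟨⟨p, qs⟩, ds⟩ h ⟨⟨p', qs'⟩, ds'⟩ h' heq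
    simp only [Finset.mem_sigma, Finset.mem_filter, Finset.mem_univ, true_and, Fintype.mem_piFinset,
      Set.Finite.mem_toFinset] at h h' heq
    obtain ⟨rfl, rfl⟩ := graft_inj h.2 h'.2 heq
    have := h.1.1.symm.trans h'.1.1
    simp only [node.injEq, heq_eq_eq, true_and] at this
    obtain rfl : qs = qs' := funext fun i => by simpa using congrFun this i
    rfl
  · intro d hd
    obtain ⟨p, qs, ds, h₁, h₂, rfl⟩ := exists_graft_of_mem_D hG ((Set.Finite.mem_toFinset _).1 hd)
    refine ⟨⟨⟨p, qs⟩, ds⟩, ?_, rfl⟩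
    simpa using ⟨h₁, h₂⟩
  · rintro ⟨⟨p, qs⟩, ds⟩ h
    rw [weight_graft]

end Grammar

namespace Grammar

variable {Sg : Type u} {rk : Sg → ℕ} {S : Type v}

/-! ### Grammars given by an indexed family of weighted productions -/

section OfRules

variable {J : Type*} {Q : Type w} [Fintype Q] [CommSemiring S]

open Classical in
/-- The grammar with the productions `pr j` for `j ∈ s`. The weights of indices with the same
production are added. -/
noncomputable abbrev ofRules (F : Q → S) (s : Finset J) (pr : J → Production rk Q) (wt : J → S) :
    Grammar.{u, v, w} rk S where
  Q := Q
  F := F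
  P := s.image pr
  wt p := ∑ j ∈ s with pr j = p.1, wt j

open Classical in
-- Different indices may yield the same production, for instance when a guessed constraint already
-- belongs to the original one. Adding their weights makes a sum over productions agree with the sum
-- over indices.
theorem sum_ofRules (F : Q → S) (s : Finset J) (pr : J → Production rk Q) (wt : J → S)
    (f : Production rk Q → S) :
    ∑ p : {p // p ∈ (ofRules F s pr wt).P}, (ofRules F s pr wt).wt p * f p.1 =
      ∑ j ∈ s, wt j * f (pr j) := by
  have h := Finset.sum_coe_sort (s.image pr) fun p => (∑ j ∈ s with pr j = p, wt j) * f p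
  refine h.trans ?_
  rw [← Finset.sum_fiberwise_of_maps_to (g := pr) fun j hj => Finset.mem_image_of_mem pr hj]
  refine Finset.sum_congr rfl fun p _ => ?_
  rw [Finset.sum_mul]
  refine Finset.sum_congr rfl fun j hj => ?_
  rw [(Finset.mem_filter.1 hj).2]

open Classical in
theorem value_ofRules_node (F : Q → S) (s : Finset J) (pr : J → Production rk Q) (wt : J → S)
    (h : (ofRules F s pr wt).IsAutomaton) (q : Q) (σ : Sg) (ts : Fin (rk σ) → ITree rk) :
    (ofRules F s pr wt).value q (node σ ts) =
      ∑ j ∈ s, wt j * ∑ qs : Fin (rk σ) → Q, if Applicable (pr j) q σ qs (node σ ts) then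
        ∏ i, (ofRules F s pr wt).value (qs i) (ts i) else 0 := by
  rw [value_node h, ← sum_ofRules F s pr wt fun p => ∑ qs : Fin (rk σ) → Q,
    if Applicable p q σ qs (node σ ts) then
      ∏ i, (ofRules F s pr wt).value (qs i) (ts i) else 0]
  refine Finset.sum_congr rfl fun p _ => ?_
  rw [Finset.mul_sum]
  refine Finset.sum_congr rfl fun qs _ => ?_
  rw [mul_ite, mul_zero]

end OfRules

/-! ### Restriction to recognizable sets of trees -/

open Classical in
/-- The set of the constraints in `C` that `t` satisfies. -/
noncomputable def satisfied (C : Finset (Pos × Pos)) (t : ITree rk) : Finset (Pos × Pos) :=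
  {c ∈ C | t.Satisfies c}

section Restrict

variable [CommSemiring S] {X : Type w} [Fintype X] (G : Grammar.{u, v, w} rk S)
  (CS : Sg → Finset (Pos × Pos))
  (δ : ∀ σ : Sg, Finset (Pos × Pos) → (Fin (rk σ) → X) → X)

/-- Indices of the productions of the product construction. -/
abbrev ProdIndex (X : Type w) (G : Grammar.{u, v, w} rk S) : Type (max u w) :=
  Σ σ : Sg, (Fin (rk σ) → G.Q) × (Fin (rk σ) → X) × {p // p ∈ G.P} × Finset (Pos × Pos)

/-- The production that simulates the production `j.2.2.2.1` together with the transition of `δ`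
for the trees that satisfy exactly the constraints `j.2.2.2.2` among those in `CS j.1`. -/
def prodRule (j : ProdIndex X G) : Production rk (G.Q × X) where
  lhs := node j.1 fun i => var (j.2.1 i, j.2.2.1 i)
  tgt := (j.2.2.2.1.1.tgt, δ j.1 j.2.2.2.2 j.2.2.1)
  E := j.2.2.2.1.1.E ∪ j.2.2.2.2
  I := j.2.2.2.1.1.I ∪ (CS j.1 \ j.2.2.2.2)
  lhs_ne _ := by simp

open Classical in
/-- The indices that belong to productions of `G`. -/
noncomputable def prodIndices [Fintype Sg] : Finset (ProdIndex X G) :=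
  {j ∈ Finset.univ.sigma fun σ =>
      Finset.univ ×ˢ Finset.univ ×ˢ Finset.univ ×ˢ (CS σ).powerset |
    j.2.2.2.1.1.lhs = node j.1 fun i => var (j.2.1 i)}

open Classical in
/-- The product of `G` with the deterministic transitions `δ` and the final states `A`. -/
noncomputable abbrev restrict [Fintype Sg] (A : Set X) : Grammar.{u, v, w} rk S :=
  ofRules (fun q : G.Q × X => if q.2 ∈ A then G.F q.1 else 0) (prodIndices G CS)
    (prodRule G CS δ) fun j => G.wt j.2.2.2.1

theorem restrict_isAutomaton [Fintype Sg] (A : Set X) : (restrict G CS δ A).IsAutomaton := by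
  classical
  intro p hp
  obtain ⟨j, -, rfl⟩ := Finset.mem_image.1 hp
  exact ⟨_, _, rfl⟩

/-- The nonterminal positions of a normalized left-hand side are the words of length one below the
root, which depend only on σ. Hence classic constraints stay classic when moved to another left-hand
side with the same symbol. -/
theorem mem_varPos_node {Z Z' : Type*} {σ : Sg} (zs : Fin (rk σ) → Z) (zs' : Fin (rk σ) → Z')
    {x : Pos} (h : x ∈ (node σ fun i => var (zs i) : RTree rk Z).varPos) :
    x ∈ (node σ fun i => var (zs' i) : RTree rk Z').varPos := by
  obtain ⟨z, hz⟩ := h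
  rcases x with _ | ⟨j, x⟩
  · simp [subtree?] at hz
  · obtain ⟨i, rfl⟩ := exists_of_cons_mem_pos ⟨_, hz⟩
    rw [subtree?_node_succ] at hz
    rcases x with _ | ⟨j, x⟩
    · exact ⟨zs' i, by rw [subtree?_node_succ, subtree?_nil]⟩
    · simp [subtree?] at hz

theorem restrict_isClassic [Fintype Sg] (A : Set X) (hG : G.IsClassic)
    (hCS : ∀ σ, ∀ c ∈ CS σ, ∃ qs : Fin (rk σ) → Unit,
      c.1 ∈ (node σ fun i => var (qs i) : RTree rk Unit).varPos ∧
      c.2 ∈ (node σ fun i => var (qs i) : RTree rk Unit).varPos) :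
    (restrict G CS δ A).IsClassic := by
  classical
  intro p hp
  obtain ⟨⟨σ, qs, xs, p, C⟩, hj, rfl⟩ := Finset.mem_image.1 hp
  simp only [prodIndices, Finset.mem_filter, Finset.mem_sigma, Finset.mem_product,
    Finset.mem_univ, true_and, Finset.mem_powerset] at hj
  obtain ⟨hC, hp⟩ := hj
  have h₁ : ∀ c, c ∈ CS σ → c.1 ∈ (prodRule G CS δ ⟨σ, qs, xs, p, C⟩).lhs.varPos ∧
      c.2 ∈ (prodRule G CS δ ⟨σ, qs, xs, p, C⟩).lhs.varPos := by
    intro c hc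
    obtain ⟨us, h, h'⟩ := hCS σ c hc
    exact ⟨mem_varPos_node us _ h, mem_varPos_node us _ h'⟩
  have h₂ : ∀ c, c ∈ p.1.E ∨ c ∈ p.1.I →
      c.1 ∈ (prodRule G CS δ ⟨σ, qs, xs, p, C⟩).lhs.varPos ∧
      c.2 ∈ (prodRule G CS δ ⟨σ, qs, xs, p, C⟩).lhs.varPos := by
    intro c hc
    have h := hG p.1 p.2 c hc
    rw [hp] at h
    exact ⟨mem_varPos_node qs _ h.1, mem_varPos_node qs _ h.2⟩
  intro c hc
  rcases hc with hc | hc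
  · rcases Finset.mem_union.1 hc with hc | hc
    · exact h₂ c (Or.inl hc)
    · exact h₁ c (hC hc)
  · rcases Finset.mem_union.1 hc with hc | hc
    · exact h₂ c (Or.inr hc)
    · exact h₁ c (Finset.mem_sdiff.1 hc).1

variable {G CS δ}

omit [CommSemiring S] [Fintype X] in
-- Constraints in `C` must hold and those in `CS σ \ C` must fail, so only the correct guess
-- survives.
theorem fulfilled_prodRule {σ : Sg} {qs : Fin (rk σ) → G.Q} {xs : Fin (rk σ) → X}
    {p : {p // p ∈ G.P}} {C : Finset (Pos × Pos)} (hC : C ⊆ CS σ) {t : ITree rk} :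
    (prodRule G CS δ ⟨σ, qs, xs, p, C⟩).Fulfilled t ↔
      p.1.Fulfilled t ∧ C = satisfied (CS σ) t := by
  classical
  simp only [Production.Fulfilled, prodRule, Finset.mem_union, Finset.mem_sdiff, or_imp,
    forall_and, satisfied, Finset.ext_iff, Finset.mem_filter]
  constructor
  · rintro ⟨⟨h₁, h₂⟩, h₃, h₄⟩
    refine ⟨⟨h₁, h₃⟩, fun c => ⟨fun hc => ⟨hC hc, h₂ c hc⟩, fun hc => ?_⟩⟩
    by_contra hc'
    exact h₄ c ⟨hc.1, hc'⟩ hc.2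
  · rintro ⟨⟨h₁, h₃⟩, h⟩
    exact ⟨⟨h₁, fun c hc => ((h c).1 hc).2⟩, h₃, fun c hc hs => hc.2 ((h c).2 ⟨hc.1, hs⟩)⟩

open Classical in
-- Induction on the tree: by the hypothesis for the subtrees only their true states contribute, and
-- by `fulfilled_prodRule` only the true set of satisfied constraints does. What remains is the
-- recursion `value_node` for `G`.
theorem value_restrict [Fintype Sg] (hG : G.IsAutomaton) {ρ : ITree rk → X}
    (hρ : ∀ σ ts, ρ (node σ ts) = δ σ (satisfied (CS σ) (node σ ts)) fun i => ρ (ts i))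
    (A : Set X) (q : G.Q) (x : X) :
    ∀ t : ITree rk,
      (restrict G CS δ A).value (q, x) t = if ρ t = x then G.value q t else 0
  | var z => z.elim
  | node τ ts => by
    have ih : ∀ q x i, (restrict G CS δ A).value (q, x) (ts i) =
        if ρ (ts i) = x then G.value q (ts i) else 0 :=
      fun q x i => value_restrict hG hρ A q x (ts i)
    set t : ITree rk := node τ ts with ht
    have hterm : ∀ (qs : Fin (rk τ) → G.Q) (xs : Fin (rk τ) → X) (p : {p // p ∈ G.P})
        (C : Finset (Pos × Pos)), C ⊆ CS τ →
        (∑ qxs : Fin (rk τ) → G.Q × X,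
          if Applicable (prodRule G CS δ ⟨τ, qs, xs, p, C⟩) (q, x) τ qxs t then
            ∏ i, (restrict G CS δ A).value (qxs i) (ts i) else 0) =
        if xs = (fun i => ρ (ts i)) ∧ C = satisfied (CS τ) t then
          if p.1.tgt = q ∧ p.1.Fulfilled t ∧ ρ t = x then ∏ i, G.value (qs i) (ts i) else 0
        else 0 := by
      intro qs xs p C hC
      -- The left-hand side of the rule determines the nonterminals of the subtrees.
      rw [Finset.sum_eq_single fun i => (qs i, xs i)]
      · simp only [ih, Fintype.prod_ite_zero]
        simp only [← ite_and]
        congr 1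
        rw [hρ, ← ht]
        simp only [Applicable, fulfilled_prodRule hC, eq_iff_iff]
        simp only [prodRule, Prod.mk.injEq, funext_iff, true_and]
        constructor
        · rintro ⟨⟨⟨h₁, h₂⟩, h₃, rfl⟩, h₄⟩
          obtain rfl : xs = fun i => ρ (ts i) := funext fun i => (h₄ i).symm
          exact ⟨⟨fun i => rfl, rfl⟩, h₁, h₃, h₂⟩
        · rintro ⟨⟨h₄, rfl⟩, h₁, h₃, h₂⟩
          obtain rfl : xs = fun i => ρ (ts i) := funext h₄
          exact ⟨⟨⟨h₁, h₂⟩, h₃, rfl⟩, fun i => rfl⟩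
      · intro qxs _ hne
        refine if_neg fun h => hne ?_
        have := h.1
        simp only [prodRule, node.injEq, heq_eq_eq, true_and] at this
        exact funext fun i => by simpa using (congrFun this i).symm
      · simp
    refine (value_ofRules_node _ _ _ _ (restrict_isAutomaton G CS δ A) _ _ _).trans ?_
    rw [prodIndices, Finset.sum_filter, Finset.sum_sigma, Finset.sum_eq_single τ]
    · simp only [Finset.sum_product]
      have hsum : ∀ qs : Fin (rk τ) → G.Q,
          (∑ xs : Fin (rk τ) → X, ∑ p : {p // p ∈ G.P}, ∑ C ∈ (CS τ).powerset,
            if p.1.lhs = node τ (fun i => var (qs i)) then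
              G.wt p * ∑ qxs : Fin (rk τ) → G.Q × X,
                if Applicable (prodRule G CS δ ⟨τ, qs, xs, p, C⟩) (q, x) τ qxs t then
                  ∏ i, (restrict G CS δ A).value (qxs i) (ts i) else 0
            else 0) =
          ∑ p : {p // p ∈ G.P}, if ρ t = x then
            if Applicable p.1 q τ qs t then G.wt p * ∏ i, G.value (qs i) (ts i) else 0 else 0 := by
        intro qs
        rw [Finset.sum_eq_single fun i => ρ (ts i)]
        · refine Finset.sum_congr rfl fun p _ => ?_
          have hmem : satisfied (CS τ) t ∈ (CS τ).powerset :=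
            Finset.mem_powerset.2 (Finset.filter_subset _ _)
          rw [Finset.sum_eq_single_of_mem _ hmem]
          · rw [(hterm _ _ _ _ (Finset.mem_powerset.1 hmem)).trans (if_pos ⟨rfl, rfl⟩)]
            by_cases h₁ : p.1.lhs = node τ fun i => var (qs i) <;> by_cases h₂ : ρ t = x <;>
              simp [h₁, h₂, Applicable]
          · intro C hC hne
            rw [(hterm _ _ _ _ (Finset.mem_powerset.1 hC)).trans (if_neg fun h => hne h.2),
              mul_zero, ite_self]
        · intro xs _ hne
          refine Finset.sum_eq_zero fun p _ => Finset.sum_eq_zero fun C hC => ?_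
          rw [(hterm _ _ _ _ (Finset.mem_powerset.1 hC)).trans (if_neg fun h => hne h.1),
            mul_zero, ite_self]
        · simp
      refine (Finset.sum_congr rfl fun qs _ => hsum qs).trans ?_
      rw [Finset.sum_comm, ht, value_node hG]
      split_ifs <;> simp
    -- Rules for another root symbol are not applicable.
    · intro σ _ hσ
      refine Finset.sum_eq_zero fun j _ => ?_
      split_ifs with h
      · rw [Finset.sum_eq_zero, mul_zero]
        intro qxs _
        refine if_neg fun h' => hσ ?_
        exact (node.inj h'.1).1
      · rfl
    · simp

open Classical in
theorem lang_restrict [Fintype Sg] (hG : G.IsAutomaton) {ρ : ITree rk → X}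
    (hρ : ∀ σ ts, ρ (node σ ts) = δ σ (satisfied (CS σ) (node σ ts)) fun i => ρ (ts i))
    (A : Set X) : (restrict G CS δ A).lang = {t | ρ t ∈ A}.indicator G.lang := by
  funext t
  rw [lang_eq, Set.indicator_apply, lang_eq]
  refine (Fintype.sum_prod_type _).trans ?_
  have h : ∀ (q : G.Q) (x : X), (restrict G CS δ A).F (q, x) *
      (restrict G CS δ A).value (q, x) t =
      if ρ t = x then (if x ∈ A then G.F q * G.value q t else 0) else 0 := by
    intro q x
    rw [value_restrict hG hρ]
    by_cases h₁ : ρ t = x <;> by_cases h₂ : x ∈ A <;> simp [h₁, h₂]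
  refine (Finset.sum_congr rfl fun q _ => Finset.sum_congr rfl fun x _ => h q x).trans ?_
  simp only [Finset.sum_ite_eq, Finset.mem_univ, if_true, Set.mem_ofPred_eq]
  split_ifs <;> simp

end Restrict
end Grammar

/-! ### Vanishing of sums and of products of powers. -/

theorem ZeroSumFree.sum_eq_zero_iff {S : Type v} [CommSemiring S] (hS : ZeroSumFree S)
    {α : Type*} (s : Finset α) (f : α → S) : ∑ a ∈ s, f a = 0 ↔ ∀ a ∈ s, f a = 0 := by
  classical
  refine ⟨fun h => ?_, Finset.sum_eq_zero⟩
  induction s using Finset.induction with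
  | empty => simp
  | insert a s ha ih =>
    rw [Finset.sum_insert ha] at h
    obtain ⟨h₁, h₂⟩ := hS _ _ h
    simpa [h₁] using ih h₂

/-- Whether a product of powers vanishes only depends on the exponents up to some threshold. -/
theorem exists_threshold {S : Type v} [CommSemiring S] {ι κ : Type*} [Fintype ι] [Finite κ]
    (F : κ → S) (f : ι → S) :
    ∃ N : ℕ, ∀ (k : κ) (a : ι → ℕ),
      F k * ∏ i, f i ^ min (a i) N = 0 ↔ F k * ∏ i, f i ^ a i = 0 := by
  have hmono : ∀ (k : κ) (a b : ι → ℕ), a ≤ b → F k * ∏ i, f i ^ a i = 0 →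
      F k * ∏ i, f i ^ b i = 0 := by
    intro k a b hab h
    have hb : ∏ i, f i ^ b i = (∏ i, f i ^ a i) * ∏ i, f i ^ (b i - a i) := by
      rw [← Finset.prod_mul_distrib]
      refine Finset.prod_congr rfl fun i _ => ?_
      rw [← pow_add, Nat.add_sub_cancel' (hab i)]
    rw [hb, ← mul_assoc, h, zero_mul]
  -- Dickson's lemma: the minimal vanishing exponent vectors for each `k` form an antichain in a
  -- well-quasi-order, hence a finite set.
  let M : Set (ι → ℕ) := ⋃ k, {a | Minimal (fun a => F k * ∏ i, f i ^ a i = 0) a}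
  have hM : M.Finite := Set.finite_iUnion fun k =>
    WellQuasiOrderedLE.finite_of_isAntichain (setOfPred_minimal_antichain _)
  obtain ⟨B, hB⟩ := hM.bddAbove
  -- Any number that dominates all coordinates of the bound `B` would do. A minimal vector below `a`
  -- then also lies below the truncation of `a`.
  refine ⟨∑ i, B i, fun k a => ⟨hmono k _ _ fun i => min_le_left _ _, fun h => ?_⟩⟩
  obtain ⟨b, hba, hb⟩ :=
    exists_minimal_le_of_wellFoundedLT (fun a => F k * ∏ i, f i ^ a i = 0) a h
  refine hmono k b _ (fun i => le_min (hba i) ?_) hb.1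
  exact (hB (Set.mem_iUnion.2 ⟨k, hb⟩) i).trans
    (Finset.single_le_sum (fun _ _ => Nat.zero_le _) (Finset.mem_univ i))

/-- Truncating the summands first is harmless: a summand above N already pushes the total to N. This
lets truncated counts be propagated bottom-up. -/
theorem min_add_sum_min {α : Type*} (s : Finset α) (a : α → ℕ) (c N : ℕ) :
    min (c + ∑ i ∈ s, min (a i) N) N = min (c + ∑ i ∈ s, a i) N := by
  classical
  induction s using Finset.induction with
  | empty => simp
  | insert i s hi ih =>
    rw [Finset.sum_insert hi, Finset.sum_insert hi]
    omega

/-! ### Profiles and the recognition of the support. -/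

namespace Grammar

variable {Sg : Type u} {rk : Sg → ℕ} {S : Type v} (G : Grammar.{u, v, w} rk S)

/-- Nonterminals together with the numbers of uses of each production, truncated at `N`. -/
abbrev Profile (N : ℕ) : Type (max u w) := G.Q × ({p // p ∈ G.P} → Fin (N + 1))

/-- Truncation of natural numbers at `N`. -/
def trunc (N m : ℕ) : Fin (N + 1) := ⟨min m N, Nat.lt_succ_of_le (min_le_right _ _)⟩

variable {G}

/-- The truncated numbers of uses of each production in `d`. -/
noncomputable def uses (N : ℕ) (d : G.Seq) (p : {p // p ∈ G.P}) : Fin (N + 1) :=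
  trunc N (mult d p)

open Classical in
theorem uses_graft (N : ℕ) {k : ℕ} (p : {p // p ∈ G.P}) (ds : Fin k → G.Seq) :
    uses N (graft p ds) =
      fun r => trunc N ((if p = r then 1 else 0) + ∑ i, (uses N (ds i) r : ℕ)) := by
  funext r
  simp only [uses, trunc, mult_graft, min_add_sum_min]

variable (G)

/-- The profiles of the derivations of `t`. -/
def profiles (N : ℕ) (t : ITree rk) : Set (G.Profile N) :=
  {y | ∃ d ∈ G.D y.1 t, uses N d = y.2}

open Classical in
/-- The profiles of a tree, computed from those of its direct subtrees and the set `C` of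
satisfied constraints. -/
def profilesStep (N : ℕ) (σ : Sg) (C : Finset (Pos × Pos))
    (Y : Fin (rk σ) → Set (G.Profile N)) : Set (G.Profile N) :=
  {y | ∃ (p : {p // p ∈ G.P}) (qs : Fin (rk σ) → G.Q)
    (ks : Fin (rk σ) → {p // p ∈ G.P} → Fin (N + 1)),
    p.1.lhs = node σ (fun i => var (qs i)) ∧ p.1.tgt = y.1 ∧
    (∀ c ∈ p.1.E, c ∈ C) ∧ (∀ c ∈ p.1.I, c ∉ C) ∧ (∀ i, (qs i, ks i) ∈ Y i) ∧
    y.2 = fun r => trunc N ((if p = r then 1 else 0) + ∑ i, (ks i r : ℕ))}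

open Classical in
/-- The constraints of the productions with the root symbol `σ`. -/
noncomputable def constraints (σ : Sg) : Finset (Pos × Pos) :=
  {p ∈ G.P | ∃ qs : Fin (rk σ) → G.Q, p.lhs = node σ fun i => var (qs i)}.biUnion
    fun p => p.E ∪ p.I

variable {G}

theorem mem_constraints {σ : Sg} {c : Pos × Pos} :
    c ∈ G.constraints σ ↔ ∃ p ∈ G.P, (∃ qs : Fin (rk σ) → G.Q, p.lhs = node σ fun i => var (qs i)) ∧
      (c ∈ p.E ∨ c ∈ p.I) := by
  simp [constraints, and_assoc]

/-- Every constraint of `p` belongs to `constraints σ`, so the finite set of satisfied ones is all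
that a transition needs to know about the tree. -/
theorem fulfilled_iff {σ : Sg} {p : Production rk G.Q} (hp : p ∈ G.P) {qs : Fin (rk σ) → G.Q}
    (hqs : p.lhs = node σ fun i => var (qs i)) (t : ITree rk) :
    p.Fulfilled t ↔ (∀ c ∈ p.E, c ∈ satisfied (G.constraints σ) t) ∧
      ∀ c ∈ p.I, c ∉ satisfied (G.constraints σ) t := by
  classical
  have h : ∀ c, c ∈ p.E ∨ c ∈ p.I → (c ∈ satisfied (G.constraints σ) t ↔ t.Satisfies c) := by
    intro c hc
    rw [satisfied, Finset.mem_filter, and_iff_right (mem_constraints.2 ⟨p, hp, ⟨qs, hqs⟩, hc⟩)]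
  exact and_congr (forall₂_congr fun c hc => (h c (Or.inl hc)).symm)
    (forall₂_congr fun c hc => not_congr (h c (Or.inr hc)).symm)

theorem profiles_node (hG : G.IsAutomaton) (N : ℕ) (σ : Sg) (ts : Fin (rk σ) → ITree rk) :
    G.profiles N (node σ ts) =
      G.profilesStep N σ (satisfied (G.constraints σ) (node σ ts))
        fun i => G.profiles N (ts i) := by
  ext ⟨q, k⟩
  constructor
  · rintro ⟨d, hd, rfl⟩
    obtain ⟨p, qs, ds, ⟨h₁, h₂, h₃⟩, h₄, rfl⟩ := exists_graft_of_mem_D hG hd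
    rw [fulfilled_iff p.2 h₁] at h₃
    exact ⟨p, qs, fun i => uses N (ds i), h₁, h₂, h₃.1, h₃.2, fun i => ⟨ds i, h₄ i, rfl⟩,
      uses_graft N p ds⟩
  · rintro ⟨p, qs, ks, h₁, h₂, h₃, h₃', h₄, rfl⟩
    choose ds hds hks using h₄
    refine ⟨graft p ds, graft_mem_D ⟨h₁, h₂, (fulfilled_iff p.2 h₁ _).2 ⟨h₃, h₃'⟩⟩ hds, ?_⟩
    rw [uses_graft]
    simp only [hks]

/-- The profiles that witness a non-zero weight. -/
def accepting [CommSemiring S] (G : Grammar.{u, v, w} rk S) (N : ℕ) : Set (Set (G.Profile N)) :=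
  {Y | ∃ y ∈ Y, G.F y.1 * ∏ p, G.wt p ^ (y.2 p : ℕ) ≠ 0}

theorem weight_eq_prod_pow [CommSemiring S] (d : G.Seq) :
    G.weight d = ∏ p, G.wt p ^ mult d p := by
  classical
  induction d with
  | nil => simp [weight, mult]
  | cons a d ih =>
    have h : G.weight (a :: d) = G.wt a.1 * G.weight d := by simp [weight]
    have h' : ∀ p, G.wt p ^ mult (a :: d) p =
        G.wt p ^ mult d p * if a.1 = p then G.wt p else 1 := by
      intro p
      simp only [mult, List.countP_cons, pow_add, decide_eq_true_eq]
      split_ifs <;> simp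
    rw [h, ih, Finset.prod_congr rfl fun p _ => h' p, Finset.prod_mul_distrib, Finset.prod_ite_eq,
      if_pos (Finset.mem_univ _), mul_comm]

/-- Zero-sum freeness reduces non-vanishing to a single derivation, and the threshold N reduces the
weight of that derivation to its profile. -/
theorem exists_lang_ne_zero_iff [CommSemiring S] (hS : ZeroSumFree S) :
    ∃ N, ∀ t, G.lang t ≠ 0 ↔ G.profiles N t ∈ G.accepting N := by
  classical
  obtain ⟨N, hN⟩ := exists_threshold G.F G.wt
  refine ⟨N, fun t => ?_⟩
  have h : G.lang t ≠ 0 ↔ ∃ q, ∃ d ∈ G.D q t, G.F q * G.weight d ≠ 0 := by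
    simp [lang, hS.sum_eq_zero_iff]
  rw [h]
  constructor
  · rintro ⟨q, d, hd, hne⟩
    refine ⟨(q, uses N d), ⟨d, hd, rfl⟩, ?_⟩
    rw [weight_eq_prod_pow] at hne
    exact (not_congr (hN q _)).2 hne
  · rintro ⟨⟨q, k⟩, ⟨d, hd, rfl⟩, hne⟩
    refine ⟨q, d, hd, ?_⟩
    rw [weight_eq_prod_pow]
    exact (not_congr (hN q _)).1 hne

theorem exists_restrict_support [Finite Sg] [CommSemiring S] (hS : ZeroSumFree S)
    (G G' : Grammar.{u, v, w} rk S) (hG : G.IsAutomaton) (hG' : G'.IsAutomaton) :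
    ∃ H : Grammar.{u, v, w} rk S, H.IsAutomaton ∧ (G.IsClassic → G'.IsClassic → H.IsClassic) ∧
      H.lang = (Function.support G'.lang).indicator G.lang := by
  have := Fintype.ofFinite Sg
  obtain ⟨N, hN⟩ := exists_lang_ne_zero_iff (G := G') hS
  obtain ⟨n, ⟨e⟩⟩ := Finite.exists_equiv_fin (Set (G'.Profile N))
  -- Sets of profiles live in a larger universe than nonterminals may, so this finite state set is
  -- replaced by a copy in universe `w`.
  let e' : Set (G'.Profile N) ≃ ULift.{w} (Fin n) := e.trans Equiv.ulift.symm
  let δ : ∀ σ : Sg, Finset (Pos × Pos) → (Fin (rk σ) → ULift.{w} (Fin n)) → ULift.{w} (Fin n) :=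
    fun σ C xs => e' (G'.profilesStep N σ C fun i => e'.symm (xs i))
  refine ⟨restrict G G'.constraints δ {x | e'.symm x ∈ G'.accepting N},
    restrict_isAutomaton _ _ _ _, fun hc hc' => restrict_isClassic _ _ _ _ hc ?_, ?_⟩
  -- The guessed constraints come from productions of `G'` with the same root symbol, so they refer
  -- to children of the root if `G'` is classic.
  · intro σ c h
    obtain ⟨p, hp, ⟨qs, hqs⟩, h⟩ := mem_constraints.1 h
    have h := hc' p hp c h
    rw [hqs] at h
    exact ⟨fun _ => (), mem_varPos_node qs _ h.1, mem_varPos_node qs _ h.2⟩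
  · rw [lang_restrict hG (ρ := fun t => e' (G'.profiles N t))]
    · congr 1
      ext t
      simp [hN]
    · intro σ ts
      simp only [δ, Equiv.symm_apply_apply, profiles_node hG']

end Grammar

end WTGc

theorem mainTheorem7 {Sg : Type u} [Finite Sg] (rk : Sg → ℕ) (S : Type v) [CommSemiring S]
    (hS : WTGc.ZeroSumFree S) :
    (∀ G G' : WTGc.Grammar.{u, v, w} rk S, G.IsAutomaton → G'.IsAutomaton →
      ∃ H : WTGc.Grammar.{u, v, w} rk S, H.IsAutomaton ∧
        H.lang = (Function.support G'.lang).indicator G.lang) ∧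
    (∀ G G' : WTGc.Grammar.{u, v, w} rk S, G.IsAutomaton → G.IsClassic →
      G'.IsAutomaton → G'.IsClassic →
      ∃ H : WTGc.Grammar.{u, v, w} rk S, H.IsAutomaton ∧ H.IsClassic ∧
        H.lang = (Function.support G'.lang).indicator G.lang) := by
  constructor
  · intro G G' hG hG'
    obtain ⟨H, hH, -, h⟩ := WTGc.Grammar.exists_restrict_support hS G G' hG hG'
    exact ⟨H, hH, h⟩
  · intro G G' hG hc hG' hc'
    obtain ⟨H, hH, hHc, h⟩ := WTGc.Grammar.exists_restrict_support hS G G' hG hG'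
    exact ⟨H, hH, hHc hc hc', h⟩
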